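/- **Conventions.** $\mathrm{su}(2)$ is the space of trace-free anti-hermitian $2\times 2$ complex matrices, with $\langle F,G\rangle=\mathrm{tr}(FG^\dagger)$. Indices are raised with the Minkowski metric $-dt^2+|dx|^2$ on $\mathbb R^{1+4}$. A smooth connection on an $SU(2)$ bundle over $\mathbb R^4$ or over a slab $(S,T)\times\mathbb R^4$ is written, in a global trivialization, as a smooth $\mathrm{su}(2)$-valued one-form $A$, with curvature $F_{\mu\nu}=\partial_\mu A_\nu-\partial_\nu A_\mu+[A_\mu,A_\nu]$ and $D_\mu=\partial_\mu+[A_\mu,\cdot]$; connections are considered up to smooth gauge transformations $A\mapsto UAU^{-1}-(dU)U^{-1}$ with $U$ valued in $SU(2)$. * A (hyperbolic) Yang–Mills connection on $(S,T)\times\mathbb R^4$ satisfies $D^\mu F_{\mu\nu}=0$. Its energy is $$\mathcal E[A](t)=\frac18\int_{\mathbb R^4}\sum_{\mu,\nu=0}^{4}\langle F_{\mu\nu},F_{\mu\nu}\rangle(t,x)\,dx ,$$ and it has finite energy if $\mathcal E[A](t)<\infty$ for all $t\in(S,T)$. $T$ is the maximal forward time of existence of $A$ if there are no $T'>T$ and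 no smooth finite energy Yang–Mills connection on $(S,T')\times\mathbb R^4$ whose restriction to $(S,T)\times\mathbb R^4$ is gauge equivalent to $A$. * An elliptic Yang–Mills connection on $\mathbb R^4$ is a smooth connection $B_0$ with $\sum_i D_iF_{ij}=0$ for all $j$; its energy is $\frac18\int\sum_{i,j=1}^4\langle F_{ij},F_{ij}\rangle\,dx$, and it is nontrivial if $F[B_0]\not\equiv 0$. A Lorentz transform of $B_0$ is the pull-back, by a linear map $\Lambda$ of $\mathbb R^{1+4}$ preserving $-t^2+|x|^2$, of the time-independent connection with zero $dt$-component defined by $B_0$. * The second Chern number of a connection on $\mathbb R^4$ is $N=\frac{1}{8\pi^2}\int_{\mathbb R^4}\mathrm{tr}(F\wedge F)$. The second Chern number of a connection on space-time is that of its restriction to a hypersurface $\{t\}\times\mathbb R^4$. * A solution $A$ on $(S,T)\times\mathbb R^4$ with $T<\infty$ *bubbles* $B$ at time $T$, where $B$ is a Lorentz transform of a nontrivial finite energy elliptic Yang–Mills connection, if there are times $t_n\in(S,T)$ with $t_n\to T$, scales $\lambda_n>0$ with $\lambda_n=o(T-t_n)$, and translations $x_n\in\mathbb R^4$ such that, for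 $A_{(n)}(t,x)=\lambda_nA(t_n+\lambda_nt,x_n+\lambda_nx)$ and suitable smooth gauge transformations $U_n$ on $(-1,1)\times\mathbb R^4$, $U_nF[A_{(n)}]U_n^{-1}\to F[B]$ in $L^2_{\mathrm{loc}}((-1,1)\times\mathbb R^4)$. **Bubbling conjecture.** For every smooth finite energy Yang–Mills connection $A$ on $(S,T_+)\times\mathbb R^4$ with maximal forward time of existence $T_+$, where $-\infty\le S<T_+\le\infty$: either $T_+=\infty$, or $A$ bubbles at $T_+$ a Lorentz transform of some nontrivial finite energy elliptic Yang–Mills connection. **Proposition.** Suppose that the bubbling conjecture is true. Let $A$ be a smooth finite energy Yang–Mills connection on $(S,T_+)\times\mathbb R^4$ whose maximal forward time of existence $T_+$ is finite, and suppose that the second Chern number of $A$ vanishes (on one hypersurface $\{t_0\}\times\mathbb R^4$, $t_0\in(S,T_+)$). Then $A$ bubbles at $T_+$ a Lorentz transform $B$ of a nontrivial finite energy elliptic Yang–Mills connection; and for every such $B$, if the second Chern number $N$ of $B$ (on any hypersurface $\{s\}\times\mathbb R^4$, $s\in\mathbb R$) is nonzero, then $$\mathcal E[A](t)\ \ge\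 2\pi^2|N|\qquad\text{for all } t\in(S,T_+).$$ -/

import Mathlib

open MeasureTheory Filter Topology Set
open scoped ContDiff Matrix ENNReal

namespace YangMills

/-- Complex `2 × 2` matrices, the ambient algebra of `SU(2)` and of its Lie algebra `su(2)`. -/
abbrev Mat2 : Type := Matrix (Fin 2) (Fin 2) ℂ

/-- Membership in `su(2)`: trace-free and anti-hermitian. -/
def IsSu2 (M : Mat2) : Prop := Mᴴ = -M ∧ M.trace = 0

/-- The squared length `⟨M, M⟩ = tr (M M†)` (a nonnegative real number). -/
noncomputable def normSqTr (M : Mat2) : ℝ := ((M * Mᴴ).trace).re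

/-- Euclidean space `ℝ⁴`. -/
abbrev Space : Type := EuclideanSpace ℝ (Fin 4)

/-- Minkowski space-time `ℝ^{1+4}`; a point is `(t, x)`. -/
abbrev Spacetime : Type := ℝ × Space

/-- The space-time slab `(S, T) × ℝ⁴`. -/
def slab (S T : EReal) : Set Spacetime := {p | S < (p.1 : EReal) ∧ (p.1 : EReal) < T}

/-- The coordinate basis `e₀, …, e₃` of `ℝ⁴`. -/
noncomputable def spaceBasis (i : Fin 4) : Space := EuclideanSpace.single i 1

/-- The coordinate basis `e₀ = ∂_t, e₁, …, e₄` of `ℝ^{1+4}`. -/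
noncomputable def spacetimeBasis : Fin 5 → Spacetime :=
  Fin.cons ((1 : ℝ), (0 : Space)) fun i : Fin 4 => ((0 : ℝ), spaceBasis i)

/-- The diagonal entries `(-1, 1, 1, 1, 1)` of the Minkowski metric. -/
def minkowskiSign : Fin 5 → ℝ := Fin.cons (-1) fun _ => 1

section Connections

variable {V W : Type*} [NormedAddCommGroup V] [NormedSpace ℝ V]
  [NormedAddCommGroup W] [NormedSpace ℝ W]

variable (V) in
/-- Matrix-valued one-forms on `V`, linear in the vector argument; `A p v` is `A` at the point `p` on the vector `v`.
Vector bundles over `ℝ⁴` and over a slab are trivial, so a connection is a global one-form. -/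
abbrev Connection : Type _ := V → V →ₗ[ℝ] Mat2

/-- A matrix-valued function is smooth on the open set `Ω`: all its entries are. -/
def IsSmoothMatOn (f : V → Mat2) (Ω : Set V) : Prop :=
  ∀ i j, ContDiffOn ℝ ∞ (fun q => f q i j) Ω

/-- The directional derivative `∂_v f (p)` of a matrix-valued function, taken entrywise. -/
noncomputable def dirDeriv (f : V → Mat2) (p v : V) : Mat2 :=
  Matrix.of fun i j => fderiv ℝ (fun q => f q i j) p v

/-- `A` is a smooth `su(2)`-valued one-form on the open set `Ω`. -/
def IsSmoothConnectionOn (A : Connection V) (Ω : Set V) : Prop :=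
  (∀ v, IsSmoothMatOn (fun q => A q v) Ω) ∧ ∀ p ∈ Ω, ∀ v, IsSu2 (A p v)

/-- The curvature `F(v, w) = ∂_v A(w) - ∂_w A(v) + [A(v), A(w)]` at the point `p`, that is,
`F_{μν} = ∂_μ A_ν - ∂_ν A_μ + [A_μ, A_ν]` on coordinate vectors. -/
noncomputable def curvature (A : Connection V) (p v w : V) : Mat2 :=
  dirDeriv (fun q => A q w) p v - dirDeriv (fun q => A q v) p w + (A p v * A p w - A p w * A p v)

/-- The covariant divergence `∑_μ η_μ D_μ F(e_μ, w)` of the curvature, with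
`D_μ = ∂_μ + [A_μ, ·]`, for coordinate vectors `e_μ` and a diagonal metric with entries `η_μ = ±1`. -/
noncomputable def covDivCurvature {ι : Type*} [Fintype ι] (e : ι → V) (η : ι → ℝ)
    (A : Connection V) (p w : V) : Mat2 :=
  ∑ μ, η μ • (dirDeriv (fun q => curvature A q (e μ) w) p (e μ)
    + (A p (e μ) * curvature A p (e μ) w - curvature A p (e μ) w * A p (e μ)))

/-- The pull-back of a connection by a linear map. -/
noncomputable def pullback (L : V →L[ℝ] W) (B : Connection W) : Connection V :=
  fun p => (B (L p)).comp L.toLinearMap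

/-- `U` is a smooth gauge transformation on `Ω`: a smooth map to `SU(2)`. -/
def IsGaugeOn (U : V → Mat2) (Ω : Set V) : Prop :=
  IsSmoothMatOn U Ω ∧ ∀ p ∈ Ω, U p ∈ Matrix.specialUnitaryGroup (Fin 2) ℂ

/-- `A'` is the gauge transform `U A U⁻¹ - (dU) U⁻¹` of `A` on `Ω` (recall `U⁻¹ = U†`). -/
def IsGaugeTransformOn (U : V → Mat2) (A A' : Connection V) (Ω : Set V) : Prop :=
  ∀ p ∈ Ω, ∀ v, A' p v = U p * A p v * (U p)ᴴ - dirDeriv U p v * (U p)ᴴ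

end Connections

/-! ### Connections on `ℝ⁴` -/

/-- `tr (F ∧ F) = (1/4) ∑_{i,j,k,l} ε_{ijkl} tr (F_{ij} F_{kl}) dx¹ ∧ dx² ∧ dx³ ∧ dx⁴`: the
coefficient function, a real number when `A` is `su(2)`-valued. -/
noncomputable def trFwedgeF (A : Connection Space) (x : Space) : ℝ :=
  (1 / 4) * ∑ σ : Equiv.Perm (Fin 4), ((Equiv.Perm.sign σ : ℤ) : ℝ) *
    ((curvature A x (spaceBasis (σ 0)) (spaceBasis (σ 1)) *
      curvature A x (spaceBasis (σ 2)) (spaceBasis (σ 3))).trace).re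

/-- The second Chern number `N = (1 / 8π²) ∫_{ℝ⁴} tr (F ∧ F)`. -/
noncomputable def secondChernNumber (A : Connection Space) : ℝ :=
  1 / (8 * Real.pi ^ 2) * ∫ x, trFwedgeF A x

/-- The static energy `(1/8) ∫_{ℝ⁴} ∑_{i,j} ⟨F_{ij}, F_{ij}⟩`, with values in `[0, ∞]`. -/
noncomputable def staticEnergy (B : Connection Space) : ℝ≥0∞ :=
  ∫⁻ x, ENNReal.ofReal (1 / 8 * ∑ i, ∑ j, normSqTr (curvature B x (spaceBasis i) (spaceBasis j)))

/-- A nontrivial (that is, non-flat) smooth finite energy elliptic Yang–Mills connection on `ℝ⁴`. -/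
structure IsNontrivialEllipticYM (B : Connection Space) : Prop where
  smooth : IsSmoothConnectionOn B univ
  equation : ∀ x, ∀ j, covDivCurvature spaceBasis (fun _ => 1) B x (spaceBasis j) = 0
  finite_energy : staticEnergy B < ⊤
  nontrivial : ∃ x v w, curvature B x v w ≠ 0

/-! ### Connections on space-time -/

/-- The restriction `A(t)` of a space-time connection to the hypersurface `{t} × ℝ⁴`. -/
noncomputable def timeSlice (t : ℝ) (A : Connection Spacetime) : Connection Space :=
  fun x => (A (t, x)).comp (LinearMap.inr ℝ ℝ Space)

/-- The energy `E[A](t) = (1/8) ∫_{ℝ⁴} ∑_{μ,ν} ⟨F_{μν}, F_{μν}⟩ dx`, with values in `[0, ∞]`. -/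
noncomputable def energy (A : Connection Spacetime) (t : ℝ) : ℝ≥0∞ :=
  ∫⁻ x : Space, ENNReal.ofReal (1 / 8 *
    ∑ μ, ∑ ν, normSqTr (curvature A (t, x) (spacetimeBasis μ) (spacetimeBasis ν)))

/-- `A` is a smooth finite energy solution on `(S, T) × ℝ⁴` of the (hyperbolic) Yang–Mills
equation `D^μ F_{μν} = 0`. -/
structure IsFiniteEnergyYMSolution (A : Connection Spacetime) (S T : EReal) : Prop where
  smooth : IsSmoothConnectionOn A (slab S T)
  equation : ∀ p ∈ slab S T, ∀ ν,
    covDivCurvature spacetimeBasis minkowskiSign A p (spacetimeBasis ν) = 0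
  finite_energy : ∀ t : ℝ, S < (t : EReal) → (t : EReal) < T → energy A t < ⊤

/-- `T` is the maximal forward time of existence of the solution `A` on `(S, T) × ℝ⁴`: as a
connection (that is, up to a gauge transformation), `A` does not extend to a smooth finite energy
solution on a longer slab `(S, T') × ℝ⁴`. -/
def IsMaximalForwardTime (A : Connection Spacetime) (S T : EReal) : Prop :=
  ¬ ∃ (T' : EReal) (A' : Connection Spacetime) (U : Spacetime → Mat2), T < T' ∧
    IsFiniteEnergyYMSolution A' S T' ∧ IsGaugeOn U (slab S T) ∧
    IsGaugeTransformOn U A A' (slab S T)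

/-- The Minkowski form `-t² + |x|²`. -/
noncomputable def minkowskiSq (p : Spacetime) : ℝ := -p.1 ^ 2 + ‖p.2‖ ^ 2

/-- Lorentz transformations of `ℝ^{1+4}`: linear maps preserving the Minkowski form. -/
def IsLorentz (Λ : Spacetime →L[ℝ] Spacetime) : Prop :=
  ∀ p, minkowskiSq (Λ p) = minkowskiSq p

/-- The Lorentz transform by `Λ` of a connection `B` on `ℝ⁴`, viewed as a time-independent
connection on `ℝ^{1+4}` with vanishing `dt`-component. -/
noncomputable def lorentzTransform (Λ : Spacetime →L[ℝ] Spacetime) (B : Connection Space) :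
    Connection Spacetime :=
  pullback Λ (pullback (ContinuousLinearMap.snd ℝ ℝ Space) B)

/-- The rescaled connection `(t, x) ↦ l A(t₀ + l t, x₀ + l x)`. -/
noncomputable def rescale (l t₀ : ℝ) (x₀ : Space) (A : Connection Spacetime) :
    Connection Spacetime :=
  fun p => l • A (t₀ + l * p.1, x₀ + l • p.2)

/-- `F[A n] → F[B]` in `L²_loc((-1, 1) × ℝ⁴)` modulo the gauge transformations `U n`, under which
the curvature becomes `U F U⁻¹`. -/
def CurvatureConverges (A : ℕ → Connection Spacetime) (U : ℕ → Spacetime → Mat2)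
    (B : Connection Spacetime) : Prop :=
  ∀ K : Set Spacetime, IsCompact K → K ⊆ slab (-1) 1 →
    Tendsto (fun n => ∫⁻ p in K, ENNReal.ofReal (∑ μ, ∑ ν, normSqTr
      (U n p * curvature (A n) p (spacetimeBasis μ) (spacetimeBasis ν) * (U n p)ᴴ
        - curvature B p (spacetimeBasis μ) (spacetimeBasis ν)))) atTop (𝓝 0)

/-- `A`, a solution on `(S, T) × ℝ⁴` with `T < ∞`, bubbles at time `T` the Lorentz transform by
`Λ` of the nontrivial finite energy elliptic Yang–Mills connection `B`. -/
def Bubbles (A : Connection Spacetime) (S : EReal) (T : ℝ) (B : Connection Space)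
    (Λ : Spacetime →L[ℝ] Spacetime) : Prop :=
  IsNontrivialEllipticYM B ∧ IsLorentz Λ ∧
  ∃ (t : ℕ → ℝ) (l : ℕ → ℝ) (x : ℕ → Space) (U : ℕ → Spacetime → Mat2),
    (∀ n, S < (t n : EReal) ∧ t n < T) ∧ Tendsto t atTop (𝓝 T) ∧
    (∀ n, 0 < l n) ∧ l =o[atTop] (fun n => T - t n) ∧
    (∀ n, IsGaugeOn (U n) (slab (-1) 1)) ∧
    CurvatureConverges (fun n => rescale (l n) (t n) (x n) A) U (lorentzTransform Λ B)

/-- The bubbling conjecture for the Yang–Mills equation on `ℝ^{1+4}`: a smooth finite energy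
solution either has maximal forward time of existence `T = ∞`, or it bubbles at time `T < ∞` a
Lorentz transform of a nontrivial finite energy elliptic Yang–Mills connection. -/
def BubblingConjecture : Prop :=
  ∀ (A : Connection Spacetime) (S T : EReal), S < T → IsFiniteEnergyYMSolution A S T →
    IsMaximalForwardTime A S T →
    T = ⊤ ∨ ∃ T₀ : ℝ, T = (T₀ : EReal) ∧ ∃ B Λ, Bubbles A S T₀ B Λ

end YangMills

/-!
The constant `2π²|N|` is the energy that the bubble alone must carry.

By the Bogomolny inequality `|tr (F ∧ F)| ≤ (1/2) ∑ |F_{ij}|²`, a time slice of the bubble with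
second Chern number `N` has static energy at least `2π²|N|`
(`ofReal_secondChernNumber_le_staticEnergy`), and the energy of the bubble at that time is at least
the static energy of the slice. So it suffices that the energy of `A` at each time `t` bounds the
energy of the bubble, `energy_bubble_le`. This rests on three facts.

* The energy of a solution does not increase in time (`energy_antitone`). The Bianchi identity and
  the Yang–Mills equation give the local law `∂_t e = ∑ ∂_i P_i` with `|P_i| ≤ 2 e`
  (`fderiv_energyDensity`, `abs_energyFlux_le`), so that the energy weighted by a cutoff of a
  backward cone decreases. The slope `8` of the cone is cruder than the speed of light, which does
  no harm on a slab over all of `ℝ⁴`.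
* The energy is scale invariant in four space dimensions (`energy_rescale`). With `λ_n = o(T - t_n)`
  and `t_n → T`, the rescaled solutions on `[-1/2, 1/2] × ℝ⁴` see only times between `t` and `T`,
  where the energy is at most that at time `t`.
* The convergence of the curvatures is only in `L²_loc` of space-time, so it controls the bubble on
  space-time cylinders. The bubble is a travelling wave (`exists_velocity`), hence its energy on a
  cylinder of unit duration bounds its energy on a slightly smaller ball at a fixed time
  (`setLIntegral_closedBall_le_unitCylinder`).

That the solution bubbles at all is the bubbling conjecture, the lifespan being finite.
-/

namespace YangMills

/-! ### Entrywise calculus of matrix-valued functions -/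

section Calculus

variable {V : Type*} [NormedAddCommGroup V] [NormedSpace ℝ V]

/-- The real inner product `Re tr (X Y†)` on `2 × 2` complex matrices, written as the sum of the
real inner products of the entries. -/
noncomputable def trInner (X Y : Mat2) : ℝ := ∑ i, ∑ j, inner ℝ (X i j) (Y i j)

theorem trInner_eq_trace (X Y : Mat2) : trInner X Y = ((X * Yᴴ).trace).re := by
  simp [trInner, Matrix.trace, Matrix.mul_apply, Complex.inner, Fin.sum_univ_two]
  ring

theorem normSqTr_eq (X : Mat2) : normSqTr X = trInner X X := (trInner_eq_trace X X).symm

theorem trInner_comm (X Y : Mat2) : trInner X Y = trInner Y X := by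
  simp only [trInner, real_inner_comm]

theorem trInner_add_left (X Y Z : Mat2) : trInner (X + Y) Z = trInner X Z + trInner Y Z := by
  simp [trInner, inner_add_left, Finset.sum_add_distrib]

theorem trInner_add_right (X Y Z : Mat2) : trInner Z (X + Y) = trInner Z X + trInner Z Y := by
  simp [trInner, inner_add_right, Finset.sum_add_distrib]

theorem trInner_neg_left (X Y : Mat2) : trInner (-X) Y = -trInner X Y := by
  simp only [trInner, Matrix.neg_apply, inner_neg_left, Finset.sum_neg_distrib]

theorem trInner_neg_right (X Y : Mat2) : trInner X (-Y) = -trInner X Y := by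
  simp only [trInner, Matrix.neg_apply, inner_neg_right, Finset.sum_neg_distrib]

theorem trInner_sub_left (X Y Z : Mat2) : trInner (X - Y) Z = trInner X Z - trInner Y Z := by
  simp [trInner, inner_sub_left, Finset.sum_sub_distrib]

theorem trInner_sub_right (X Y Z : Mat2) : trInner Z (X - Y) = trInner Z X - trInner Z Y := by
  simp [trInner, inner_sub_right, Finset.sum_sub_distrib]

theorem trInner_sum_left {ι : Type*} (s : Finset ι) (X : ι → Mat2) (Y : Mat2) :
    trInner (∑ k ∈ s, X k) Y = ∑ k ∈ s, trInner (X k) Y := by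
  classical
  induction s using Finset.induction_on with
  | empty => simp [trInner]
  | insert a s ha ih => rw [Finset.sum_insert ha, Finset.sum_insert ha, trInner_add_left, ih]

theorem normSqTr_nonneg (X : Mat2) : 0 ≤ normSqTr X := by
  rw [normSqTr_eq]
  exact Finset.sum_nonneg fun i _ => Finset.sum_nonneg fun j _ => real_inner_self_nonneg

theorem normSqTr_smul (c : ℝ) (X : Mat2) : normSqTr (c • X) = c ^ 2 * normSqTr X := by
  simp only [normSqTr_eq, trInner, Matrix.smul_apply, inner_smul_left, inner_smul_right,
    Finset.mul_sum]
  refine Finset.sum_congr rfl fun i _ => Finset.sum_congr rfl fun j _ => ?_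
  simp only [conj_trivial]
  ring

theorem normSqTr_conjTranspose (X : Mat2) : normSqTr Xᴴ = normSqTr X := by
  rw [normSqTr, normSqTr, Matrix.conjTranspose_conjTranspose, Matrix.trace_mul_comm]

theorem abs_trInner_le (X Y : Mat2) : |trInner X Y| ≤ (normSqTr X + normSqTr Y) / 2 := by
  have h₁ := normSqTr_nonneg (X - Y)
  have h₂ := normSqTr_nonneg (X + Y)
  simp only [normSqTr_eq, trInner_sub_left, trInner_sub_right, trInner_add_left,
    trInner_add_right, trInner_comm Y X] at *
  rw [abs_le]
  constructor <;> linarith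

/-- `ad X` is skew for the trace inner product when `X` is anti-hermitian. -/
theorem trInner_commutator {X : Mat2} (hX : Xᴴ = -X) (Y Z : Mat2) :
    trInner (X * Y - Y * X) Z + trInner Y (X * Z - Z * X) = 0 := by
  simp only [trInner_eq_trace, ← Complex.add_re, ← Matrix.trace_add, Matrix.conjTranspose_sub,
    Matrix.conjTranspose_mul, hX]
  have h : (X * Y - Y * X) * Zᴴ + Y * (Zᴴ * -X - -X * Zᴴ) = X * (Y * Zᴴ) - (Y * Zᴴ) * X := by
    noncomm_ring
  rw [h, Matrix.trace_sub, Matrix.trace_mul_comm, sub_self, Complex.zero_re]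

theorem IsSmoothMatOn.add {f g : V → Mat2} {Ω : Set V} (hf : IsSmoothMatOn f Ω)
    (hg : IsSmoothMatOn g Ω) : IsSmoothMatOn (fun q => f q + g q) Ω :=
  fun i j => (hf i j).add (hg i j)

theorem IsSmoothMatOn.sub {f g : V → Mat2} {Ω : Set V} (hf : IsSmoothMatOn f Ω)
    (hg : IsSmoothMatOn g Ω) : IsSmoothMatOn (fun q => f q - g q) Ω :=
  fun i j => (hf i j).sub (hg i j)

theorem IsSmoothMatOn.mul {f g : V → Mat2} {Ω : Set V} (hf : IsSmoothMatOn f Ω)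
    (hg : IsSmoothMatOn g Ω) : IsSmoothMatOn (fun q => f q * g q) Ω := fun i j => by
  simp only [Matrix.mul_apply]
  exact ContDiffOn.sum fun k _ => (hf i k).mul (hg k j)

theorem IsSmoothMatOn.differentiableAt {f : V → Mat2} {Ω : Set V} (hf : IsSmoothMatOn f Ω)
    (hΩ : IsOpen Ω) {p : V} (hp : p ∈ Ω) (i j : Fin 2) :
    DifferentiableAt ℝ (fun q => f q i j) p :=
  ((hf i j).contDiffAt (hΩ.mem_nhds hp)).differentiableAt (by simp)

theorem IsSmoothMatOn.dirDeriv {f : V → Mat2} {Ω : Set V} (hf : IsSmoothMatOn f Ω)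
    (hΩ : IsOpen Ω) (v : V) : IsSmoothMatOn (fun q => dirDeriv f q v) Ω := fun i j => by
  have h := (hf i j).fderiv_of_isOpen (m := ∞) hΩ (by simp)
  exact h.clm_apply contDiffOn_const

theorem dirDeriv_add {f g : V → Mat2} {Ω : Set V} (hf : IsSmoothMatOn f Ω)
    (hg : IsSmoothMatOn g Ω) (hΩ : IsOpen Ω) {p : V} (hp : p ∈ Ω) (v : V) :
    dirDeriv (fun q => f q + g q) p v = dirDeriv f p v + dirDeriv g p v := by
  ext i j
  simp only [dirDeriv, Matrix.of_apply, Matrix.add_apply]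
  rw [fderiv_fun_add (hf.differentiableAt hΩ hp i j) (hg.differentiableAt hΩ hp i j)]
  rfl

theorem dirDeriv_sub {f g : V → Mat2} {Ω : Set V} (hf : IsSmoothMatOn f Ω)
    (hg : IsSmoothMatOn g Ω) (hΩ : IsOpen Ω) {p : V} (hp : p ∈ Ω) (v : V) :
    dirDeriv (fun q => f q - g q) p v = dirDeriv f p v - dirDeriv g p v := by
  ext i j
  simp only [dirDeriv, Matrix.of_apply, Matrix.sub_apply]
  rw [fderiv_fun_sub (hf.differentiableAt hΩ hp i j) (hg.differentiableAt hΩ hp i j)]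
  rfl

theorem dirDeriv_mul {f g : V → Mat2} {Ω : Set V} (hf : IsSmoothMatOn f Ω)
    (hg : IsSmoothMatOn g Ω) (hΩ : IsOpen Ω) {p : V} (hp : p ∈ Ω) (v : V) :
    dirDeriv (fun q => f q * g q) p v = dirDeriv f p v * g p + f p * dirDeriv g p v := by
  ext i j
  have hf' := hf.differentiableAt hΩ hp
  have hg' := hg.differentiableAt hΩ hp
  simp only [dirDeriv, Matrix.of_apply, Matrix.add_apply, Matrix.mul_apply]
  rw [fderiv_fun_sum fun k _ => (hf' i k).fun_mul (hg' k j), sum_apply,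
    ← Finset.sum_add_distrib]
  refine Finset.sum_congr rfl fun k _ => ?_
  rw [fderiv_fun_mul (hf' i k) (hg' k j)]
  simp only [add_apply, smul_apply, smul_eq_mul]
  ring

/-- Second directional derivatives of a smooth matrix-valued function commute. -/
theorem dirDeriv_comm {f : V → Mat2} {Ω : Set V} (hf : IsSmoothMatOn f Ω) (hΩ : IsOpen Ω) {p : V}
    (hp : p ∈ Ω) (v w : V) :
    dirDeriv (fun q => dirDeriv f q v) p w = dirDeriv (fun q => dirDeriv f q w) p v := by
  ext i j
  have hs := (hf i j).contDiffAt (hΩ.mem_nhds hp)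
  have hd : DifferentiableAt ℝ (fun q => fderiv ℝ (fun q => f q i j) q) p :=
    (((hf i j).fderiv_of_isOpen (m := ∞) hΩ (by simp)).contDiffAt
      (hΩ.mem_nhds hp)).differentiableAt (by simp)
  simp only [dirDeriv, Matrix.of_apply]
  rw [fderiv_clm_apply hd (differentiableAt_const v),
    fderiv_clm_apply hd (differentiableAt_const w)]
  simpa using (hs.isSymmSndFDerivAt (by simpa using ENat.LEInfty.out)) w v

theorem IsSmoothMatOn.trInner {f g : V → Mat2} {Ω : Set V} (hf : IsSmoothMatOn f Ω)
    (hg : IsSmoothMatOn g Ω) : ContDiffOn ℝ ∞ (fun q => trInner (f q) (g q)) Ω :=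
  ContDiffOn.sum fun i _ => ContDiffOn.sum fun j _ => (hf i j).inner ℝ (hg i j)

theorem fderiv_trInner {f g : V → Mat2} {Ω : Set V} (hf : IsSmoothMatOn f Ω)
    (hg : IsSmoothMatOn g Ω) (hΩ : IsOpen Ω) {p : V} (hp : p ∈ Ω) (v : V) :
    fderiv ℝ (fun q => trInner (f q) (g q)) p v =
      trInner (dirDeriv f p v) (g p) + trInner (f p) (dirDeriv g p v) := by
  have hf' := hf.differentiableAt hΩ hp
  have hg' := hg.differentiableAt hΩ hp
  simp only [trInner]
  rw [fderiv_fun_sum fun i _ => DifferentiableAt.fun_sum fun j _ => (hf' i j).inner ℝ (hg' i j),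
    sum_apply, ← Finset.sum_add_distrib]
  refine Finset.sum_congr rfl fun i _ => ?_
  rw [fderiv_fun_sum fun j _ => (hf' i j).inner ℝ (hg' i j), sum_apply,
    ← Finset.sum_add_distrib]
  refine Finset.sum_congr rfl fun j _ => ?_
  rw [fderiv_inner_apply ℝ (hf' i j) (hg' i j), add_comm]
  rfl

/-- The covariant derivative `D_v G = ∂_v G + [A(v), G]` of a matrix-valued function. -/
noncomputable def covDeriv (A : Connection V) (G : V → Mat2) (p v : V) : Mat2 :=
  dirDeriv G p v + (A p v * G p - G p * A p v)

variable {A : Connection V} {Ω : Set V}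

theorem IsSmoothConnectionOn.curvature (hA : IsSmoothConnectionOn A Ω) (hΩ : IsOpen Ω) (v w : V) :
    IsSmoothMatOn (fun q => curvature A q v w) Ω :=
  (((hA.1 w).dirDeriv hΩ v).sub ((hA.1 v).dirDeriv hΩ w)).add
    (((hA.1 v).mul (hA.1 w)).sub ((hA.1 w).mul (hA.1 v)))

theorem curvature_swap (A : Connection V) (p v w : V) : curvature A p w v = -curvature A p v w := by
  simp only [curvature]
  abel

theorem dirDeriv_neg (f : V → Mat2) (p v : V) :
    dirDeriv (fun q => -f q) p v = -dirDeriv f p v := by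
  ext i j
  simp [dirDeriv]

theorem covDeriv_curvature_swap (A : Connection V) (p u v w : V) :
    covDeriv A (fun q => curvature A q w v) p u = -covDeriv A (fun q => curvature A q v w) p u := by
  simp only [covDeriv, curvature_swap A _ v w, dirDeriv_neg]
  noncomm_ring

/-- Compatibility of the covariant derivative of an `su(2)`-connection with the trace inner
product. -/
theorem fderiv_trInner_covDeriv (hA : IsSmoothConnectionOn A Ω) {f g : V → Mat2}
    (hf : IsSmoothMatOn f Ω) (hg : IsSmoothMatOn g Ω) (hΩ : IsOpen Ω) {p : V} (hp : p ∈ Ω)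
    (v : V) :
    fderiv ℝ (fun q => trInner (f q) (g q)) p v =
      trInner (covDeriv A f p v) (g p) + trInner (f p) (covDeriv A g p v) := by
  have h := trInner_commutator (hA.2 p hp v).1 (f p) (g p)
  rw [fderiv_trInner hf hg hΩ hp, covDeriv, covDeriv, trInner_add_left, trInner_add_right]
  linarith

/-- The Bianchi identity. -/
theorem bianchi (hA : IsSmoothConnectionOn A Ω) (hΩ : IsOpen Ω) {p : V} (hp : p ∈ Ω)
    (u v w : V) :
    covDeriv A (fun q => curvature A q v w) p u + covDeriv A (fun q => curvature A q w u) p v +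
      covDeriv A (fun q => curvature A q u v) p w = 0 := by
  have key : ∀ a b c : V, dirDeriv (fun q => curvature A q b c) p a =
      dirDeriv (fun q => dirDeriv (fun q => A q c) q b) p a
        - dirDeriv (fun q => dirDeriv (fun q => A q b) q c) p a
        + (dirDeriv (fun q => A q b) p a * A p c + A p b * dirDeriv (fun q => A q c) p a
          - (dirDeriv (fun q => A q c) p a * A p b
            + A p c * dirDeriv (fun q => A q b) p a)) := by
    intro a b c
    simp only [curvature]
    rw [dirDeriv_add (((hA.1 c).dirDeriv hΩ b).sub ((hA.1 b).dirDeriv hΩ c))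
        (((hA.1 b).mul (hA.1 c)).sub ((hA.1 c).mul (hA.1 b))) hΩ hp,
      dirDeriv_sub ((hA.1 c).dirDeriv hΩ b) ((hA.1 b).dirDeriv hΩ c) hΩ hp,
      dirDeriv_sub ((hA.1 b).mul (hA.1 c)) ((hA.1 c).mul (hA.1 b)) hΩ hp,
      dirDeriv_mul (hA.1 b) (hA.1 c) hΩ hp, dirDeriv_mul (hA.1 c) (hA.1 b) hΩ hp]
  simp only [covDeriv, key]
  rw [dirDeriv_comm (hA.1 w) hΩ hp v u, dirDeriv_comm (hA.1 u) hΩ hp w v,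
    dirDeriv_comm (hA.1 v) hΩ hp u w]
  simp only [curvature]
  noncomm_ring

end Calculus

/-! ### The energy density and its local conservation law -/

theorem isOpen_slab (S T : EReal) : IsOpen (slab S T) :=
  (isOpen_lt continuous_const (continuous_coe_real_ereal.comp continuous_fst)).inter
    (isOpen_lt (continuous_coe_real_ereal.comp continuous_fst) continuous_const)

/-- The energy density `(1/8) ∑_{μ,ν} ⟨F_{μν}, F_{μν}⟩`. -/
noncomputable def energyDensity (A : Connection Spacetime) (p : Spacetime) : ℝ :=
  1 / 8 * ∑ μ, ∑ ν, normSqTr (curvature A p (spacetimeBasis μ) (spacetimeBasis ν))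

/-- The energy flux `P_i = (1/2) ∑_ν ⟨F_{iν}, F_{0ν}⟩`; the term `ν = 0` vanishes. -/
noncomputable def energyFlux (A : Connection Spacetime) (i : Fin 4) (p : Spacetime) : ℝ :=
  1 / 2 * ∑ ν, trInner (curvature A p (spacetimeBasis i.succ) (spacetimeBasis ν))
    (curvature A p (spacetimeBasis 0) (spacetimeBasis ν))

theorem energyDensity_nonneg (A : Connection Spacetime) (p : Spacetime) :
    0 ≤ energyDensity A p :=
  mul_nonneg (by norm_num)
    (Finset.sum_nonneg fun _ _ => Finset.sum_nonneg fun _ _ => normSqTr_nonneg _)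

theorem energy_eq_lintegral (A : Connection Spacetime) (t : ℝ) :
    energy A t = ∫⁻ x : Space, ENNReal.ofReal (energyDensity A (t, x)) := rfl

theorem abs_energyFlux_le (A : Connection Spacetime) (i : Fin 4) (p : Spacetime) :
    |energyFlux A i p| ≤ 2 * energyDensity A p := by
  set f : Fin 5 → ℝ := fun μ =>
    ∑ ν, normSqTr (curvature A p (spacetimeBasis μ) (spacetimeBasis ν)) with hf
  have hf0 : ∀ μ, 0 ≤ f μ := fun μ => Finset.sum_nonneg fun _ _ => normSqTr_nonneg _
  have h₁ : |energyFlux A i p| ≤ 1 / 2 * ((f i.succ + f 0) / 2) := by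
    rw [energyFlux, abs_mul, abs_of_pos (by norm_num : (0 : ℝ) < 1 / 2)]
    refine mul_le_mul_of_nonneg_left ?_ (by norm_num)
    refine (Finset.abs_sum_le_sum_abs _ _).trans ?_
    rw [hf, ← Finset.sum_add_distrib, Finset.sum_div]
    exact Finset.sum_le_sum fun ν _ => abs_trInner_le _ _
  have h₂ : f i.succ + f 0 ≤ ∑ μ, f μ := by
    rw [Fin.sum_univ_succ, add_comm]
    gcongr
    exact Finset.single_le_sum (f := fun j : Fin 4 => f j.succ) (fun j _ => hf0 _)
      (Finset.mem_univ i)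
  have h₃ : energyDensity A p = 1 / 8 * ∑ μ, f μ := rfl
  linarith

/-- The algebra behind energy conservation, for arrays `F μ ν` and `D l μ ν` of matrices in the
roles of `F_{μν}` and `D_l F_{μν}`: the Bianchi identity and the Yang–Mills equation turn
`⟨D_0 F_{μν}, F_{μν}⟩` into a spatial divergence. -/
theorem sum_trInner_eq_of_bianchi (F : Fin 5 → Fin 5 → Mat2) (D : Fin 5 → Fin 5 → Fin 5 → Mat2)
    (hF : ∀ μ ν, F ν μ = -F μ ν) (hD : ∀ l μ ν, D l ν μ = -D l μ ν)
    (hB : ∀ l μ ν, D l μ ν + D μ ν l + D ν l μ = 0)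
    (hYM : ∀ ν, D 0 0 ν = ∑ i : Fin 4, D i.succ i.succ ν) :
    1 / 4 * ∑ μ, ∑ ν, trInner (D 0 μ ν) (F μ ν) =
      ∑ i : Fin 4, 1 / 2 * ∑ ν, (trInner (D i.succ i.succ ν) (F 0 ν)
        + trInner (F i.succ ν) (D i.succ 0 ν)) := by
  have hF0 : ∀ X μ, trInner X (F μ μ) = 0 := fun X μ => by
    have h := congrArg (trInner X) (hF μ μ)
    rw [trInner_neg_right] at h
    linarith
  have hD0 : ∀ X l μ, trInner X (D l μ μ) = 0 := fun X l μ => by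
    have h := congrArg (trInner X) (hD l μ μ)
    rw [trInner_neg_right] at h
    linarith
  have hmix : ∀ j : Fin 4, trInner (D 0 j.succ 0) (F j.succ 0) =
      trInner (D 0 0 j.succ) (F 0 j.succ) := fun j => by
    rw [hD 0 0 j.succ, hF 0 j.succ, trInner_neg_left, trInner_neg_right, neg_neg]
  have hdiv : ∑ j : Fin 4, trInner (D 0 0 j.succ) (F 0 j.succ) =
      ∑ i : Fin 4, ∑ j : Fin 4, trInner (D i.succ i.succ j.succ) (F 0 j.succ) := by
    rw [Finset.sum_comm]
    refine Finset.sum_congr rfl fun j _ => ?_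
    rw [hYM, trInner_sum_left]
  have hcurl : ∑ i : Fin 4, ∑ j : Fin 4, trInner (D 0 i.succ j.succ) (F i.succ j.succ) =
      2 * ∑ i : Fin 4, ∑ j : Fin 4, trInner (F i.succ j.succ) (D i.succ 0 j.succ) := by
    have h : ∀ i j : Fin 4, trInner (D 0 i.succ j.succ) (F i.succ j.succ) =
        trInner (F i.succ j.succ) (D i.succ 0 j.succ)
          + trInner (F j.succ i.succ) (D j.succ 0 i.succ) := fun i j => by
      have hb := congrArg (fun X => trInner X (F i.succ j.succ)) (hB 0 i.succ j.succ)
      have hz : trInner 0 (F i.succ j.succ) = 0 := by simp [trInner]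
      simp only [trInner_add_left, hz] at hb
      rw [hD i.succ 0 j.succ, trInner_neg_left] at hb
      rw [hF i.succ j.succ, trInner_neg_left, trInner_comm (F i.succ j.succ),
        trInner_comm (F i.succ j.succ)]
      linarith
    simp only [h, Finset.sum_add_distrib]
    rw [Finset.sum_comm (f := fun i j : Fin 4 => trInner (F j.succ i.succ) (D j.succ 0 i.succ))]
    ring
  simp only [Fin.sum_univ_succ (n := 4), hF0, hD0, hmix, Finset.sum_add_distrib, ← Finset.mul_sum]
  rw [hdiv, hcurl]
  simp only [Finset.sum_const_zero]
  ring

section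

variable {A : Connection Spacetime} {S T : EReal}

theorem contDiffOn_energyDensity (hA : IsSmoothConnectionOn A (slab S T)) :
    ContDiffOn ℝ ∞ (energyDensity A) (slab S T) := by
  have h : ∀ μ ν, ContDiffOn ℝ ∞ (fun p =>
      normSqTr (curvature A p (spacetimeBasis μ) (spacetimeBasis ν))) (slab S T) := fun μ ν => by
    simp only [normSqTr_eq]
    exact (hA.curvature (isOpen_slab S T) _ _).trInner (hA.curvature (isOpen_slab S T) _ _)
  exact contDiffOn_const.mul (ContDiffOn.sum fun μ _ => ContDiffOn.sum fun ν _ => h μ ν)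

theorem contDiffOn_energyFlux (hA : IsSmoothConnectionOn A (slab S T)) (i : Fin 4) :
    ContDiffOn ℝ ∞ (energyFlux A i) (slab S T) :=
  contDiffOn_const.mul (ContDiffOn.sum fun _ _ =>
    (hA.curvature (isOpen_slab S T) _ _).trInner (hA.curvature (isOpen_slab S T) _ _))

/-- Local conservation of energy, `∂_t e = ∑_i ∂_i P_i`. -/
theorem fderiv_energyDensity (hA : IsSmoothConnectionOn A (slab S T))
    (hYM : ∀ p ∈ slab S T, ∀ ν,
      covDivCurvature spacetimeBasis minkowskiSign A p (spacetimeBasis ν) = 0)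
    {p : Spacetime} (hp : p ∈ slab S T) :
    fderiv ℝ (energyDensity A) p (spacetimeBasis 0) =
      ∑ i : Fin 4, fderiv ℝ (energyFlux A i) p (spacetimeBasis i.succ) := by
  have hΩ := isOpen_slab S T
  have hFs := fun μ ν => hA.curvature hΩ (spacetimeBasis μ) (spacetimeBasis ν)
  have hd : ∀ μ ν μ' ν', DifferentiableAt ℝ (fun q =>
      trInner (curvature A q (spacetimeBasis μ) (spacetimeBasis ν))
        (curvature A q (spacetimeBasis μ') (spacetimeBasis ν'))) p := fun μ ν μ' ν' =>
    (((hFs μ ν).trInner (hFs μ' ν')).contDiffAt (hΩ.mem_nhds hp)).differentiableAt (by simp)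
  set F : Fin 5 → Fin 5 → Mat2 := fun μ ν =>
    curvature A p (spacetimeBasis μ) (spacetimeBasis ν) with hF
  set D : Fin 5 → Fin 5 → Fin 5 → Mat2 := fun l μ ν =>
    covDeriv A (fun q => curvature A q (spacetimeBasis μ) (spacetimeBasis ν)) p
      (spacetimeBasis l) with hD
  have hl : fderiv ℝ (energyDensity A) p (spacetimeBasis 0) =
      1 / 4 * ∑ μ, ∑ ν, trInner (D 0 μ ν) (F μ ν) := by
    have he : energyDensity A = fun q => 1 / 8 * ∑ μ, ∑ ν,
        trInner (curvature A q (spacetimeBasis μ) (spacetimeBasis ν))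
          (curvature A q (spacetimeBasis μ) (spacetimeBasis ν)) := by
      funext q
      simp only [energyDensity, normSqTr_eq]
    rw [he, fderiv_const_mul (DifferentiableAt.fun_sum fun μ _ =>
      DifferentiableAt.fun_sum fun ν _ => hd μ ν μ ν),
      fderiv_fun_sum (fun μ _ => DifferentiableAt.fun_sum fun ν _ => hd μ ν μ ν),
      smul_apply, sum_apply, smul_eq_mul, Finset.mul_sum, Finset.mul_sum]
    refine Finset.sum_congr rfl fun μ _ => ?_
    rw [fderiv_fun_sum (fun ν _ => hd μ ν μ ν), sum_apply, Finset.mul_sum, Finset.mul_sum]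
    refine Finset.sum_congr rfl fun ν _ => ?_
    rw [fderiv_trInner_covDeriv hA (hFs μ ν) (hFs μ ν) hΩ hp, trInner_comm (F μ ν)]
    ring
  have hr : ∀ i : Fin 4, fderiv ℝ (energyFlux A i) p (spacetimeBasis i.succ) =
      1 / 2 * ∑ ν, (trInner (D i.succ i.succ ν) (F 0 ν)
        + trInner (F i.succ ν) (D i.succ 0 ν)) := fun i => by
    unfold energyFlux
    rw [fderiv_const_mul (DifferentiableAt.fun_sum fun ν _ => hd _ _ _ _),
      fderiv_fun_sum (fun ν _ => hd _ _ _ _), smul_apply, sum_apply, smul_eq_mul]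
    congr 1
    refine Finset.sum_congr rfl fun ν _ => ?_
    rw [fderiv_trInner_covDeriv hA (hFs _ _) (hFs _ _) hΩ hp]
  rw [hl, Finset.sum_congr rfl fun i _ => hr i]
  refine sum_trInner_eq_of_bianchi F D (fun μ ν => curvature_swap _ _ _ _)
    (fun l μ ν => covDeriv_curvature_swap _ _ _ _ _) (fun l μ ν => bianchi hA hΩ hp _ _ _)
    fun ν => ?_
  have h : ∑ μ, minkowskiSign μ • D μ μ ν = 0 := hYM p hp ν
  rw [Fin.sum_univ_succ] at h
  simp only [minkowskiSign, Fin.cons_zero, Fin.cons_succ, neg_smul, one_smul] at h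
  exact (neg_add_eq_zero.1 h)

end

/-! ### Integrals over time slices of functions with compact spatial support -/

section Slices

variable {ψ : Spacetime → ℝ} {I : Set ℝ} {K : Set Space}

theorem fderiv_eq_zero_of_notMem (hI : IsOpen I) (hK : IsCompact K)
    (hψ0 : ∀ s ∈ I, ∀ x ∉ K, ψ (s, x) = 0) {s : ℝ} (hs : s ∈ I) {x : Space} (hx : x ∉ K) :
    fderiv ℝ ψ (s, x) = 0 := by
  have h : ψ =ᶠ[𝓝 (s, x)] fun _ => 0 := by
    filter_upwards [(hI.prod hK.isClosed.isOpen_compl).mem_nhds ⟨hs, hx⟩] with q hq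
    exact hψ0 q.1 hq.1 q.2 hq.2
  rw [h.fderiv_eq, fderiv_fun_const, Pi.zero_apply]

theorem continuousOn_fderiv_apply (hI : IsOpen I) (hψ : ContDiffOn ℝ ∞ ψ (I ×ˢ univ))
    (v : Spacetime) : ContinuousOn (fun p => fderiv ℝ ψ p v) (I ×ˢ univ) :=
  ((hψ.fderiv_of_isOpen (m := ∞) (hI.prod isOpen_univ) (by simp)).continuousOn).clm_apply
    continuousOn_const

theorem integrable_slice {f : Spacetime → ℝ} (hf : ContinuousOn f (I ×ˢ univ)) (hK : IsCompact K)
    {s : ℝ} (hs : s ∈ I) (hf0 : ∀ x ∉ K, f (s, x) = 0) :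
    Integrable fun x : Space => f (s, x) := by
  have hc : Continuous fun x : Space => f (s, x) :=
    hf.comp_continuous (by fun_prop) fun x => ⟨hs, mem_univ x⟩
  exact hc.integrable_of_hasCompactSupport (HasCompactSupport.intro hK hf0)

theorem integrable_slice_fderiv (hI : IsOpen I) (hK : IsCompact K)
    (hψ : ContDiffOn ℝ ∞ ψ (I ×ˢ univ)) (hψ0 : ∀ s ∈ I, ∀ x ∉ K, ψ (s, x) = 0) {s : ℝ}
    (hs : s ∈ I) (v : Spacetime) : Integrable fun x : Space => fderiv ℝ ψ (s, x) v :=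
  integrable_slice (continuousOn_fderiv_apply hI hψ v) hK hs fun x hx => by
    rw [fderiv_eq_zero_of_notMem hI hK hψ0 hs hx, zero_apply]

/-- Differentiation under the integral sign over a time slice. -/
theorem hasDerivAt_integral_slice (hI : IsOpen I) (hK : IsCompact K)
    (hψ : ContDiffOn ℝ ∞ ψ (I ×ˢ univ)) (hψ0 : ∀ s ∈ I, ∀ x ∉ K, ψ (s, x) = 0) {s : ℝ}
    (hs : s ∈ I) :
    HasDerivAt (fun s => ∫ x, ψ (s, x)) (∫ x, fderiv ℝ ψ (s, x) (1, 0)) s := by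
  obtain ⟨ε, hε, hεI⟩ := Metric.nhds_basis_closedBall.mem_iff.1 (hI.mem_nhds hs)
  have hcd := continuousOn_fderiv_apply hI hψ (1, 0)
  obtain ⟨C, hC⟩ := ((isCompact_closedBall s ε).prod hK).exists_bound_of_continuousOn
    (hcd.mono (prod_mono hεI (subset_univ _)))
  refine (hasDerivAt_integral_of_dominated_loc_of_deriv_le
    (F := fun s x => ψ (s, x)) (F' := fun s x => fderiv ℝ ψ (s, x) (1, 0))
    (bound := K.indicator fun _ => C) (Metric.closedBall_mem_nhds s hε) ?_ ?_ ?_ ?_ ?_ ?_).2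
  · filter_upwards [hI.mem_nhds hs] with r hr
    exact (integrable_slice hψ.continuousOn hK hr (hψ0 r hr)).aestronglyMeasurable
  · exact integrable_slice hψ.continuousOn hK hs (hψ0 s hs)
  · exact (integrable_slice_fderiv hI hK hψ hψ0 hs _).aestronglyMeasurable
  · refine Eventually.of_forall fun x r hr => ?_
    by_cases hx : x ∈ K
    · rw [indicator_of_mem hx]
      exact hC (r, x) ⟨hr, hx⟩
    · rw [indicator_of_notMem hx, fderiv_eq_zero_of_notMem hI hK hψ0 (hεI hr) hx]
      simp
  · exact (integrable_indicator_iff hK.measurableSet).2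
      (integrableOn_const hK.measure_lt_top.ne)
  · refine Eventually.of_forall fun x r hr => ?_
    have hd : DifferentiableAt ℝ ψ (r, x) :=
      (hψ.contDiffAt ((hI.prod isOpen_univ).mem_nhds ⟨hεI hr, mem_univ x⟩)).differentiableAt
        (by simp)
    have hl : HasDerivAt (fun r : ℝ => (r, x)) ((1 : ℝ), (0 : Space)) r :=
      (hasDerivAt_id r).prodMk (hasDerivAt_const r x)
    exact hd.hasFDerivAt.comp_hasDerivAt r hl

/-- The integral of a spatial derivative of a function with compact spatial support vanishes. -/
theorem integral_slice_fderiv_eq_zero (hI : IsOpen I) (hK : IsCompact K)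
    (hψ : ContDiffOn ℝ ∞ ψ (I ×ˢ univ)) (hψ0 : ∀ s ∈ I, ∀ x ∉ K, ψ (s, x) = 0) {s : ℝ}
    (hs : s ∈ I) (v : Space) : ∫ x, fderiv ℝ ψ (s, x) (0, v) = 0 := by
  have hd : ∀ x : Space, HasFDerivAt (fun x => ψ (s, x))
      ((fderiv ℝ ψ (s, x)).comp (ContinuousLinearMap.inr ℝ ℝ Space)) x := fun x => by
    have h : DifferentiableAt ℝ ψ (s, x) :=
      (hψ.contDiffAt ((hI.prod isOpen_univ).mem_nhds ⟨hs, mem_univ x⟩)).differentiableAt (by simp)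
    exact h.hasFDerivAt.comp x (hasFDerivAt_prodMk_right s x)
  have he : ∀ x, fderiv ℝ (fun x => ψ (s, x)) x v = fderiv ℝ ψ (s, x) (0, v) := fun x => by
    rw [(hd x).fderiv]
    rfl
  have h := integral_mul_fderiv_eq_neg_fderiv_mul_of_integrable (μ := (volume : Measure Space))
    (f := fun _ => (1 : ℝ)) (g := fun x => ψ (s, x)) (v := v) (by simp)
    (by simpa [he] using integrable_slice_fderiv hI hK hψ hψ0 hs _)
    (by simpa using integrable_slice hψ.continuousOn hK hs (hψ0 s hs))
    (fun x _ => differentiableAt_const _) (fun x _ => (hd x).differentiableAt)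
  simpa [he] using h

end Slices

/-! ### Monotonicity of the energy -/

/-- A cutoff of the truncated backward light cones of slope `8`: it equals `1` where
`√(1 + |x|²) ≤ R - 8 t - 1` and vanishes where `√(1 + |x|²) ≥ R - 8 t`. -/
noncomputable def coneCutoff (R : ℝ) (p : Spacetime) : ℝ :=
  Real.smoothTransition (R - 8 * p.1 - √(1 + ‖p.2‖ ^ 2))

theorem contDiff_coneCutoff (R : ℝ) : ContDiff ℝ ∞ (coneCutoff R) := by
  refine Real.smoothTransition.contDiff.comp ?_
  refine (contDiff_const.sub (contDiff_const.mul contDiff_fst)).sub (ContDiff.sqrt ?_ fun p => ?_)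
  · exact contDiff_const.add (contDiff_snd.norm_sq ℝ)
  · positivity

/-- The cutoff decreases in time at least `8` times as fast as it varies in space. -/
theorem abs_fderiv_coneCutoff_le (R : ℝ) (p : Spacetime) (i : Fin 4) :
    8 * |fderiv ℝ (coneCutoff R) p (spacetimeBasis i.succ)| ≤
      -fderiv ℝ (coneCutoff R) p (spacetimeBasis 0) := by
  have hpos : 0 < √(1 + ‖p.2‖ ^ 2) := Real.sqrt_pos.2 (by positivity)
  have hn : HasFDerivAt (fun q : Spacetime => ‖q.2‖ ^ 2)
      (2 • (innerSL ℝ p.2).comp (ContinuousLinearMap.snd ℝ ℝ Space)) p := by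
    simpa using (hasFDerivAt_snd (𝕜 := ℝ) (p := p)).norm_sq
  have hq := ((((hasFDerivAt_fst (𝕜 := ℝ) (p := p)).const_mul 8).const_sub R).sub
    ((hn.const_add 1).sqrt (by positivity)))
  set d := deriv Real.smoothTransition (R - 8 * p.1 - √(1 + ‖p.2‖ ^ 2)) with hd
  have hχ : HasDerivAt Real.smoothTransition d (R - 8 * p.1 - √(1 + ‖p.2‖ ^ 2)) :=
    ((Real.smoothTransition.contDiff (n := 1)).differentiable (by simp) _).hasDerivAt
  have hd0 : 0 ≤ d := Real.smoothTransition.monotone.deriv_nonneg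
  have hf := (hχ.comp_hasFDerivAt p hq).fderiv
  have hf' : fderiv ℝ (coneCutoff R) p = _ := hf
  have h0 : fderiv ℝ (coneCutoff R) p (spacetimeBasis 0) = d * (-8) := by
    rw [hf']
    simp [spacetimeBasis]
  have hi : fderiv ℝ (coneCutoff R) p (spacetimeBasis i.succ) =
      d * (-(p.2 i / √(1 + ‖p.2‖ ^ 2))) := by
    rw [hf']
    simp [spacetimeBasis, spaceBasis, EuclideanSpace.inner_single_right]
    left
    field_simp
  have hle : |p.2 i / √(1 + ‖p.2‖ ^ 2)| ≤ 1 := by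
    rw [abs_div, abs_of_pos hpos, div_le_one hpos]
    have h : ‖p.2 i‖ ≤ ‖p.2‖ := PiLp.norm_apply_le p.2 i
    exact (Real.norm_eq_abs _ ▸ h).trans (Real.le_sqrt_of_sq_le (by linarith))
  rw [h0, hi, abs_mul, abs_neg, abs_of_nonneg hd0]
  nlinarith

theorem lintegral_le_of_forall_closedBall {f : Space → ℝ≥0∞} (hf : AEMeasurable f volume)
    {C : ℝ≥0∞} (h : ∀ r : ℝ, ∫⁻ x in Metric.closedBall 0 r, f x ≤ C) : ∫⁻ x, f x ≤ C :=
  le_of_tendsto' ((aecover_closedBall (x := (0 : Space))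
    tendsto_id).lintegral_tendsto_of_countably_generated hf) h

variable {A : Connection Spacetime} {S T : EReal}

theorem slab_eq_prod (S T : EReal) :
    slab S T = {s : ℝ | S < (s : EReal) ∧ (s : EReal) < T} ×ˢ univ := by
  ext p
  simp [slab]

theorem continuous_energyDensity_slice (hA : IsSmoothConnectionOn A (slab S T)) {s : ℝ}
    (hS : S < (s : EReal)) (hT : (s : EReal) < T) :
    Continuous fun x : Space => energyDensity A (s, x) :=
  (contDiffOn_energyDensity hA).continuousOn.comp_continuous (by fun_prop) fun _ => ⟨hS, hT⟩

/-- The energy weighted by `coneCutoff` is nonincreasing in time. -/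
theorem integral_coneCutoff_antitone (hA : IsFiniteEnergyYMSolution A S T) (R : ℝ) {t τ : ℝ}
    (hS : S < (t : EReal)) (htτ : t ≤ τ) (hT : (τ : EReal) < T) :
    ∫ x, coneCutoff R (τ, x) * energyDensity A (τ, x) ≤
      ∫ x, coneCutoff R (t, x) * energyDensity A (t, x) := by
  set I : Set ℝ := {s : ℝ | S < (s : EReal) ∧ (s : EReal) < T} ∩ Ioi (t - 1) with hIdef
  set K : Set Space := Metric.closedBall 0 (R - 8 * (t - 1)) with hKdef
  have hI : IsOpen I := ((isOpen_lt continuous_const continuous_coe_real_ereal).inter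
    (isOpen_lt continuous_coe_real_ereal continuous_const)).inter isOpen_Ioi
  have hK : IsCompact K := isCompact_closedBall _ _
  have hIS : I ×ˢ (univ : Set Space) ⊆ slab S T := by
    rw [slab_eq_prod]
    exact prod_mono inter_subset_left subset_rfl
  have hφ0 : ∀ s ∈ I, ∀ x ∉ K, coneCutoff R (s, x) = 0 := by
    intro s hs x hx
    refine Real.smoothTransition.zero_of_nonpos ?_
    have h₁ : t - 1 < s := hs.2
    have h₂ : R - 8 * (t - 1) < ‖x‖ := by simpa [hKdef] using hx
    have h₃ : ‖x‖ ≤ √(1 + ‖x‖ ^ 2) := Real.le_sqrt_of_sq_le (by linarith)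
    simp only
    linarith
  have hsm : ∀ {g : Spacetime → ℝ}, ContDiffOn ℝ ∞ g (slab S T) →
      ContDiffOn ℝ ∞ (fun p => coneCutoff R p * g p) (I ×ˢ univ) := fun hg =>
    (contDiff_coneCutoff R).contDiffOn.mul (hg.mono hIS)
  have hvan : ∀ g : Spacetime → ℝ, ∀ s ∈ I, ∀ x ∉ K, coneCutoff R (s, x) * g (s, x) = 0 :=
    fun g s hs x hx => by rw [hφ0 s hs x hx, zero_mul]
  have hder : ∀ s ∈ I, HasDerivAt
      (fun s => ∫ x, coneCutoff R (s, x) * energyDensity A (s, x)) _ s := fun s hs =>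
    hasDerivAt_integral_slice hI hK (hsm (contDiffOn_energyDensity hA.smooth)) (hvan _) hs
  have hprod : ∀ {g : Spacetime → ℝ}, ContDiffOn ℝ ∞ g (slab S T) → ∀ p ∈ slab S T, ∀ v,
      fderiv ℝ (fun p => coneCutoff R p * g p) p v =
        fderiv ℝ (coneCutoff R) p v * g p + coneCutoff R p * fderiv ℝ g p v := by
    intro g hg p hp v
    rw [fderiv_fun_mul ((contDiff_coneCutoff R).differentiable (by simp) p)
      ((hg.contDiffAt ((isOpen_slab S T).mem_nhds hp)).differentiableAt (by simp))]
    simp only [add_apply, smul_apply, smul_eq_mul]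
    ring
  have hle : ∀ s ∈ I, ∫ x, fderiv ℝ (fun p => coneCutoff R p * energyDensity A p) (s, x)
      (1, 0) ≤ 0 := by
    intro s hs
    have hz : ∫ x, ∑ i : Fin 4, fderiv ℝ (fun p => coneCutoff R p * energyFlux A i p) (s, x)
        (spacetimeBasis i.succ) = 0 := by
      rw [integral_finsetSum _ fun i _ => integrable_slice_fderiv hI hK
        (hsm (contDiffOn_energyFlux hA.smooth i)) (hvan _) hs _]
      exact Finset.sum_eq_zero fun i _ => integral_slice_fderiv_eq_zero hI hK
        (hsm (contDiffOn_energyFlux hA.smooth i)) (hvan _) hs _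
    rw [← hz]
    refine integral_mono (integrable_slice_fderiv hI hK
        (hsm (contDiffOn_energyDensity hA.smooth)) (hvan _) hs _)
      (integrable_finsetSum _ fun i _ => integrable_slice_fderiv hI hK
        (hsm (contDiffOn_energyFlux hA.smooth i)) (hvan _) hs _) fun x => ?_
    have hp : (s, x) ∈ slab S T := hIS ⟨hs, mem_univ x⟩
    have he := hprod (contDiffOn_energyDensity hA.smooth) _ hp (spacetimeBasis 0)
    rw [fderiv_energyDensity hA.smooth hA.equation hp, Finset.mul_sum] at he
    change fderiv ℝ (fun p => coneCutoff R p * energyDensity A p) (s, x) (spacetimeBasis 0) ≤ _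
    rw [he]
    simp only [hprod (contDiffOn_energyFlux hA.smooth _) _ hp, Finset.sum_add_distrib]
    refine add_le_add_left ?_ _
    have hE := energyDensity_nonneg A (s, x)
    have hterm : ∀ i : Fin 4, 1 / 4 * (fderiv ℝ (coneCutoff R) (s, x) (spacetimeBasis 0) *
        energyDensity A (s, x)) ≤
        fderiv ℝ (coneCutoff R) (s, x) (spacetimeBasis i.succ) * energyFlux A i (s, x) := by
      intro i
      have h₁ := abs_fderiv_coneCutoff_le R (s, x) i
      have h₂ := abs_energyFlux_le A i (s, x)
      have h₃ := mul_le_mul h₁ h₂ (abs_nonneg _) ((by positivity : (0 : ℝ) ≤ _).trans h₁)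
      have h₄ := neg_abs_le (fderiv ℝ (coneCutoff R) (s, x) (spacetimeBasis i.succ) *
        energyFlux A i (s, x))
      rw [abs_mul] at h₄
      linarith
    have h := Finset.sum_le_sum fun i (_ : i ∈ Finset.univ) => hterm i
    simpa using h
  have hIcc : Icc t τ ⊆ I := fun s hs =>
    ⟨⟨hS.trans_le (EReal.coe_le_coe_iff.2 hs.1), (EReal.coe_le_coe_iff.2 hs.2).trans_lt hT⟩,
      by have := hs.1; simp only [mem_Ioi]; linarith⟩
  refine antitoneOn_of_deriv_nonpos (convex_Icc t τ)
    (fun s hs => (hder s (hIcc hs)).continuousAt.continuousWithinAt)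
    (fun s hs => (hder s (hIcc (interior_subset hs))).differentiableAt.differentiableWithinAt)
    (fun s hs => ?_) (left_mem_Icc.2 htτ) (right_mem_Icc.2 htτ) htτ
  rw [(hder s (hIcc (interior_subset hs))).deriv]
  exact hle s (hIcc (interior_subset hs))

theorem integrable_coneCutoff_mul (hA : IsSmoothConnectionOn A (slab S T)) (R : ℝ) {s : ℝ}
    (hS : S < (s : EReal)) (hT : (s : EReal) < T) :
    Integrable fun x : Space => coneCutoff R (s, x) * energyDensity A (s, x) := by
  have hc : Continuous fun x : Space => coneCutoff R (s, x) * energyDensity A (s, x) :=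
    ((contDiff_coneCutoff R).continuous.comp (by fun_prop)).mul
      (continuous_energyDensity_slice hA hS hT)
  refine hc.integrable_of_hasCompactSupport
    (HasCompactSupport.intro (isCompact_closedBall 0 (R - 8 * s)) fun x hx => ?_)
  have h₂ : R - 8 * s < ‖x‖ := by simpa using hx
  have h₃ : ‖x‖ ≤ √(1 + ‖x‖ ^ 2) := Real.le_sqrt_of_sq_le (by linarith)
  rw [coneCutoff, Real.smoothTransition.zero_of_nonpos (by simp only; linarith), zero_mul]

/-- The energy of a finite energy Yang–Mills solution is nonincreasing in time. (It is conserved,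
but only this direction is needed here.) -/
theorem energy_antitone (hA : IsFiniteEnergyYMSolution A S T) {t τ : ℝ}
    (hS : S < (t : EReal)) (htτ : t ≤ τ) (hT : (τ : EReal) < T) : energy A τ ≤ energy A t := by
  have hSτ : S < (τ : EReal) := hS.trans_le (EReal.coe_le_coe_iff.2 htτ)
  have hTt : (t : EReal) < T := (EReal.coe_le_coe_iff.2 htτ).trans_lt hT
  rw [energy_eq_lintegral, energy_eq_lintegral]
  refine lintegral_le_of_forall_closedBall
    (continuous_energyDensity_slice hA.smooth hSτ hT).measurable.ennreal_ofReal.aemeasurable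
    fun r => ?_
  -- the cutoff with this `R` equals `1` on the ball of radius `r` at time `τ`
  set R := 8 * τ + 1 + √(1 + r ^ 2) with hR
  have hnn : ∀ s : ℝ, ∀ x : Space, 0 ≤ coneCutoff R (s, x) * energyDensity A (s, x) := fun s x =>
    mul_nonneg (Real.smoothTransition.nonneg _) (energyDensity_nonneg _ _)
  calc ∫⁻ x in Metric.closedBall 0 r, ENNReal.ofReal (energyDensity A (τ, x))
      ≤ ∫⁻ x in Metric.closedBall 0 r,
          ENNReal.ofReal (coneCutoff R (τ, x) * energyDensity A (τ, x)) := by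
        refine setLIntegral_mono' measurableSet_closedBall fun x hx => ?_
        have hx' : ‖x‖ ≤ r := by simpa using hx
        have h : √(1 + ‖x‖ ^ 2) ≤ √(1 + r ^ 2) := by gcongr
        rw [coneCutoff, Real.smoothTransition.one_of_one_le (by simp only [hR]; linarith), one_mul]
    _ ≤ ∫⁻ x, ENNReal.ofReal (coneCutoff R (τ, x) * energyDensity A (τ, x)) :=
        setLIntegral_le_lintegral _ _
    _ = ENNReal.ofReal (∫ x, coneCutoff R (τ, x) * energyDensity A (τ, x)) :=
        (ofReal_integral_eq_lintegral_ofReal (integrable_coneCutoff_mul hA.smooth R hSτ hT)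
          (Eventually.of_forall (hnn τ))).symm
    _ ≤ ENNReal.ofReal (∫ x, coneCutoff R (t, x) * energyDensity A (t, x)) :=
        ENNReal.ofReal_le_ofReal (integral_coneCutoff_antitone hA R hS htτ hT)
    _ = ∫⁻ x, ENNReal.ofReal (coneCutoff R (t, x) * energyDensity A (t, x)) :=
        ofReal_integral_eq_lintegral_ofReal (integrable_coneCutoff_mul hA.smooth R hS hTt)
          (Eventually.of_forall (hnn t))
    _ ≤ ∫⁻ x, ENNReal.ofReal (energyDensity A (t, x)) :=
        lintegral_mono fun x => ENNReal.ofReal_le_ofReal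
          (mul_le_of_le_one_left (energyDensity_nonneg _ _) (Real.smoothTransition.le_one _))

/-! ### The Bogomolny inequality -/

/-- A sum over permutations of a function of two of their values; each ordered pair of distinct
indices arises from exactly two permutations of four letters. -/
theorem sum_perm_le {g : Fin 4 → Fin 4 → ℝ} (hg : ∀ i j, 0 ≤ g i j) (a b : Fin 4) (hab : a ≠ b) :
    ∑ σ : Equiv.Perm (Fin 4), g (σ a) (σ b) ≤ 2 * ∑ i, ∑ j, g i j := by
  have hcard : ∀ a b : Fin 4, a ≠ b → ∀ q : Fin 4 × Fin 4,
      (Finset.univ.filter fun σ : Equiv.Perm (Fin 4) => (σ a, σ b) = q).card ≤ 2 := by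
    decide +kernel
  rw [← Finset.sum_fiberwise (s := Finset.univ)
    (g := fun σ : Equiv.Perm (Fin 4) => (σ a, σ b)), ← Fintype.sum_prod_type', Finset.mul_sum]
  refine Finset.sum_le_sum fun q _ => ?_
  rw [Finset.sum_congr rfl (g := fun _ => g q.1 q.2) fun σ hσ => by
    rw [← (Finset.mem_filter.1 hσ).2], Finset.sum_const, nsmul_eq_mul]
  exact mul_le_mul_of_nonneg_right (by exact_mod_cast hcard a b hab q) (hg _ _)

theorem abs_trFwedgeF_le (A : Connection Space) (x : Space) :
    |trFwedgeF A x| ≤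
      1 / 2 * ∑ i, ∑ j, normSqTr (curvature A x (spaceBasis i) (spaceBasis j)) := by
  set g : Fin 4 → Fin 4 → ℝ := fun i j =>
    normSqTr (curvature A x (spaceBasis i) (spaceBasis j)) with hg
  have hg0 : ∀ i j, 0 ≤ g i j := fun i j => normSqTr_nonneg _
  have hterm : ∀ σ : Equiv.Perm (Fin 4), |((Equiv.Perm.sign σ : ℤ) : ℝ) *
      ((curvature A x (spaceBasis (σ 0)) (spaceBasis (σ 1)) *
        curvature A x (spaceBasis (σ 2)) (spaceBasis (σ 3))).trace).re| ≤
      (g (σ 0) (σ 1) + g (σ 2) (σ 3)) / 2 := fun σ => by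
    have hs : |((Equiv.Perm.sign σ : ℤ) : ℝ)| = 1 := by
      rcases Int.units_eq_one_or (Equiv.Perm.sign σ) with h | h <;> simp [h]
    have h := abs_trInner_le (curvature A x (spaceBasis (σ 0)) (spaceBasis (σ 1)))
      (curvature A x (spaceBasis (σ 2)) (spaceBasis (σ 3)))ᴴ
    rw [trInner_eq_trace, Matrix.conjTranspose_conjTranspose, normSqTr_conjTranspose] at h
    rw [abs_mul, hs, one_mul]
    exact h
  have h₁ := sum_perm_le hg0 0 1 (by decide)
  have h₂ := sum_perm_le hg0 2 3 (by decide)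
  have h₃ := (Finset.abs_sum_le_sum_abs _ _).trans
    (Finset.sum_le_sum fun σ (_ : σ ∈ Finset.univ) => hterm σ)
  rw [← Finset.sum_div, Finset.sum_add_distrib] at h₃
  rw [trFwedgeF, abs_mul, abs_of_pos (by norm_num : (0 : ℝ) < 1 / 4)]
  linarith

/-- The Bogomolny inequality. When `tr (F ∧ F)` is not integrable, the second Chern number has the
value `0` and the bound is trivially true. -/
theorem ofReal_secondChernNumber_le_staticEnergy (A : Connection Space) :
    ENNReal.ofReal (2 * Real.pi ^ 2 * |secondChernNumber A|) ≤ staticEnergy A := by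
  have h : 2 * Real.pi ^ 2 * |secondChernNumber A| = |∫ x, 1 / 4 * trFwedgeF A x| := by
    rw [integral_const_mul, secondChernNumber, abs_mul, abs_mul,
      abs_of_pos (by positivity : (0 : ℝ) < 1 / (8 * Real.pi ^ 2)),
      abs_of_pos (by norm_num : (0 : ℝ) < 1 / 4)]
    field_simp
    ring
  rw [h, ← Real.enorm_eq_ofReal_abs]
  refine (enorm_integral_le_lintegral_enorm _).trans (lintegral_mono fun x => ?_)
  rw [Real.enorm_eq_ofReal_abs, abs_mul, abs_of_pos (by norm_num : (0 : ℝ) < 1 / 4)]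
  refine ENNReal.ofReal_le_ofReal ?_
  have := abs_trFwedgeF_le A x
  linarith

theorem curvature_timeSlice {A : Connection Spacetime} (hA : IsSmoothConnectionOn A univ) (s : ℝ)
    (x v w : Space) :
    curvature (timeSlice s A) x v w = curvature A (s, x) (0, v) (0, w) := by
  have h : ∀ a b : Space, dirDeriv (fun y => timeSlice s A y a) x b =
      dirDeriv (fun q => A q (0, a)) (s, x) (0, b) := fun a b => by
    ext i j
    have hd := ((hA.1 (0, a)).differentiableAt isOpen_univ (mem_univ (s, x)) i j).hasFDerivAt.comp x
      (hasFDerivAt_prodMk_right (𝕜 := ℝ) s x)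
    exact congrArg (fun L : Space →L[ℝ] ℂ => L b) hd.fderiv
  simp only [curvature, h]
  rfl

theorem staticEnergy_timeSlice_le {A : Connection Spacetime} (hA : IsSmoothConnectionOn A univ)
    (s : ℝ) : staticEnergy (timeSlice s A) ≤ energy A s := by
  refine lintegral_mono fun x => ENNReal.ofReal_le_ofReal ?_
  refine mul_le_mul_of_nonneg_left ?_ (by norm_num)
  simp only [Fin.sum_univ_succ (n := 4), curvature_timeSlice hA]
  refine le_add_of_nonneg_of_le (add_nonneg (normSqTr_nonneg _)
    (Finset.sum_nonneg fun _ _ => normSqTr_nonneg _)) (Finset.sum_le_sum fun i _ => ?_)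
  exact le_add_of_nonneg_left (normSqTr_nonneg _)

/-! ### Rescaling -/

theorem curvature_rescale (l t₀ : ℝ) (x₀ : Space) (A : Connection Spacetime)
    (p v w : Spacetime) :
    curvature (rescale l t₀ x₀ A) p v w =
      l ^ 2 • curvature A (t₀ + l * p.1, x₀ + l • p.2) v w := by
  have h : ∀ a b : Spacetime, dirDeriv (fun q => rescale l t₀ x₀ A q a) p b =
      l ^ 2 • dirDeriv (fun q => A q a) (t₀ + l * p.1, x₀ + l • p.2) b := fun a b => by
    ext i j
    have hfun : (fun q => rescale l t₀ x₀ A q a i j) =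
        l • fun q => (fun q' => A ((t₀, x₀) + q') a i j) (l • q) := by
      funext q
      simp [rescale, Prod.add_def, Prod.smul_def]
    simp only [dirDeriv, Matrix.of_apply, Matrix.smul_apply]
    rw [hfun, fderiv_const_smul_field, Pi.smul_apply,
      fderiv_comp_smul (f := fun q' => A ((t₀, x₀) + q') a i j),
      fderiv_comp_add_left (f := fun q' => A q' a i j)]
    simp [Prod.add_def, Prod.smul_def, smul_smul, sq]
  simp only [curvature, h]
  have h' : ∀ a, rescale l t₀ x₀ A p a = l • A (t₀ + l * p.1, x₀ + l • p.2) a := fun a => rfl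
  simp only [h', Matrix.smul_mul, Matrix.mul_smul, smul_smul, sq, smul_add, smul_sub]

theorem energyDensity_rescale (l t₀ : ℝ) (x₀ : Space) (A : Connection Spacetime)
    (p : Spacetime) :
    energyDensity (rescale l t₀ x₀ A) p =
      l ^ 4 * energyDensity A (t₀ + l * p.1, x₀ + l • p.2) := by
  simp only [energyDensity, curvature_rescale, normSqTr_smul, ← Finset.mul_sum]
  ring

/-- In four space dimensions the energy is invariant under rescaling. -/
theorem energy_rescale {l : ℝ} (hl : 0 < l) (t₀ : ℝ) (x₀ : Space) (A : Connection Spacetime)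
    (s : ℝ) : energy (rescale l t₀ x₀ A) s = energy A (t₀ + l * s) := by
  simp only [energy_eq_lintegral, energyDensity_rescale,
    ENNReal.ofReal_mul (by positivity : 0 ≤ l ^ 4)]
  rw [lintegral_const_mul' _ _ ENNReal.ofReal_ne_top]
  set f : Space → ℝ≥0∞ := fun x => ENNReal.ofReal (energyDensity A (t₀ + l * s, x)) with hf
  have hm : ∫⁻ x : Space, f (x₀ + l • x) =
      ENNReal.ofReal |(l ^ 4)⁻¹| * ∫⁻ x : Space, f (x₀ + x) := by
    have h := Measure.map_addHaar_smul (volume : Measure Space) hl.ne'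
    rw [finrank_euclideanSpace, Fintype.card_fin] at h
    rw [← smul_eq_mul, ← lintegral_smul_measure, ← h]
    exact ((Homeomorph.smulOfNeZero l hl.ne').measurableEmbedding.lintegral_map
      fun x => f (x₀ + x)).symm
  change ENNReal.ofReal (l ^ 4) * ∫⁻ x : Space, f (x₀ + l • x) = ∫⁻ x, f x
  rw [hm, lintegral_add_left_eq_self, ← mul_assoc, ← ENNReal.ofReal_mul (by positivity),
    abs_of_pos (by positivity), mul_inv_cancel₀ (by positivity), ENNReal.ofReal_one, one_mul]

/-! ### Lorentz transforms of static connections -/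

theorem curvature_add_of_periodic {V : Type*} [NormedAddCommGroup V] [NormedSpace ℝ V]
    {A : Connection V} {c : V} (h : ∀ p, A (p + c) = A p) (p v w : V) :
    curvature A (p + c) v w = curvature A p v w := by
  have hd : ∀ a b : V, dirDeriv (fun q => A q a) (p + c) b = dirDeriv (fun q => A q a) p b := by
    intro a b
    ext i j
    simp only [dirDeriv, Matrix.of_apply]
    rw [← fderiv_comp_add_right (f := fun q => A q a i j)]
    simp only [h]
  simp only [curvature, hd, h]

theorem isSmoothConnectionOn_lorentzTransform {B : Connection Space}
    (hB : IsSmoothConnectionOn B univ) (Λ : Spacetime →L[ℝ] Spacetime) :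
    IsSmoothConnectionOn (lorentzTransform Λ B) univ := by
  refine ⟨fun v i j => ?_, fun p _ v => hB.2 _ (mem_univ _) _⟩
  have h : ContDiff ℝ ∞ fun y => B y (Λ v).2 i j := contDiffOn_univ.1 (hB.1 (Λ v).2 i j)
  exact (h.comp (contDiff_snd.comp Λ.contDiff)).contDiffOn

/-- A Lorentz transform of a static connection is a travelling wave: it is invariant under the
translations along the preimage of the time axis, which is not contained in a time slice. -/
theorem exists_velocity {Λ : Spacetime →L[ℝ] Spacetime} (hΛ : IsLorentz Λ) (B : Connection Space) :
    ∃ v : Space, ∀ (h : ℝ) (p : Spacetime),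
      lorentzTransform Λ B (p + (h, -(h • v))) = lorentzTransform Λ B p := by
  set M : Space →ₗ[ℝ] Space := LinearMap.snd ℝ ℝ Space ∘ₗ Λ.toLinearMap ∘ₗ LinearMap.inr ℝ ℝ Space
    with hM
  have hinj : Function.Injective M := by
    refine (injective_iff_map_eq_zero M).2 fun x hx => ?_
    have hx' : (Λ (0, x)).2 = 0 := hx
    have h := hΛ (0, x)
    simp only [minkowskiSq, hx', norm_zero] at h
    have h0 : ‖x‖ ^ 2 = 0 := by nlinarith [sq_nonneg (Λ (0, x)).1, sq_nonneg ‖x‖]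
    simpa using h0
  obtain ⟨v, hv⟩ := LinearMap.injective_iff_surjective.1 hinj (Λ (1, 0)).2
  have hv' : (Λ (0, v)).2 = (Λ (1, 0)).2 := hv
  refine ⟨v, fun h p => ?_⟩
  have hz : (Λ (p + (h, -(h • v)))).2 = (Λ p).2 := by
    have : ((h, -(h • v)) : Spacetime) = h • ((1, 0) - (0, v)) := by simp
    rw [map_add, this, map_smul, map_sub, Prod.snd_add, Prod.smul_snd, Prod.snd_sub, hv', sub_self,
      smul_zero, add_zero]
  simp only [lorentzTransform, pullback, ContinuousLinearMap.coe_snd', hz]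

theorem energyDensity_eq_of_velocity {B : Connection Spacetime} {v : Space}
    (hv : ∀ (h : ℝ) (p : Spacetime), B (p + (h, -(h • v))) = B p) (s : ℝ) (x : Space) :
    energyDensity B (s, x) = energyDensity B (0, x + s • v) := by
  have h : ((s, x) : Spacetime) = (0, x + s • v) + (s, -(s • v)) := by simp
  rw [h]
  simp only [energyDensity, curvature_add_of_periodic (hv s)]

theorem energy_eq_of_velocity {B : Connection Spacetime} {v : Space}
    (hv : ∀ (h : ℝ) (p : Spacetime), B (p + (h, -(h • v))) = B p) (s : ℝ) :
    energy B s = energy B 0 := by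
  simp only [energy_eq_lintegral, energyDensity_eq_of_velocity hv s]
  exact lintegral_add_right_eq_self (fun x => ENNReal.ofReal (energyDensity B (0, x))) (s • v)

/-! ### Energy of a bubble -/

theorem normSqTr_unitary_conj {U : Mat2} (hU : U ∈ Matrix.specialUnitaryGroup (Fin 2) ℂ)
    (X : Mat2) : normSqTr (U * X * Uᴴ) = normSqTr X := by
  have h : Uᴴ * U = 1 := Matrix.mem_unitaryGroup_iff'.1 (Matrix.mem_specialUnitaryGroup_iff.1 hU).1
  have h' : U * X * Uᴴ * (U * X * Uᴴ)ᴴ = U * (X * Xᴴ * Uᴴ) := by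
    simp only [Matrix.conjTranspose_mul, Matrix.conjTranspose_conjTranspose, Matrix.mul_assoc]
    rw [← Matrix.mul_assoc Uᴴ U, h, Matrix.one_mul]
  rw [normSqTr, normSqTr, h', Matrix.trace_mul_comm, Matrix.mul_assoc, h, Matrix.mul_one]

/-- A triangle inequality for squared lengths, with the constant of `X` arbitrarily close to `1`. -/
theorem normSqTr_le_add {δ : ℝ} (hδ : 0 < δ) (X Y : Mat2) :
    normSqTr Y ≤ (1 + δ) * normSqTr X + (1 + 1 / δ) * normSqTr (X - Y) := by
  have h : 0 ≤ 1 / δ * normSqTr (δ • X + (X - Y)) :=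
    mul_nonneg (by positivity) (normSqTr_nonneg _)
  have hY : normSqTr Y = normSqTr (X - (X - Y)) := by rw [sub_sub_cancel]
  have hs : trInner (δ • X) (X - Y) = δ * trInner X (X - Y) := by
    simp only [trInner, Matrix.smul_apply, inner_smul_left, Finset.mul_sum, conj_trivial]
  rw [normSqTr_eq, trInner_add_left, trInner_add_right, trInner_add_right, ← normSqTr_eq,
    ← normSqTr_eq, trInner_comm (X - Y), hs, normSqTr_smul] at h
  rw [hY, normSqTr_eq (X - (X - Y)), trInner_sub_left, trInner_sub_right X (X - Y) X,
    trInner_sub_right X (X - Y) (X - Y), trInner_comm (X - Y) X, ← normSqTr_eq, ← normSqTr_eq]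
  have h' : 1 / δ * (δ ^ 2 * normSqTr X + δ * trInner X (X - Y) +
      (δ * trInner X (X - Y) + normSqTr (X - Y))) =
      δ * normSqTr X + 2 * trInner X (X - Y) + 1 / δ * normSqTr (X - Y) := by
    field_simp
    ring
  rw [h'] at h
  linarith

theorem energyDensity_le_add {A B : Connection Spacetime} {U : Mat2}
    (hU : U ∈ Matrix.specialUnitaryGroup (Fin 2) ℂ) {δ : ℝ} (hδ : 0 < δ) (p : Spacetime) :
    energyDensity B p ≤ (1 + δ) * energyDensity A p + (1 + 1 / δ) * ∑ μ, ∑ ν, normSqTr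
      (U * curvature A p (spacetimeBasis μ) (spacetimeBasis ν) * Uᴴ
        - curvature B p (spacetimeBasis μ) (spacetimeBasis ν)) := by
  set d := ∑ μ, ∑ ν, normSqTr (U * curvature A p (spacetimeBasis μ) (spacetimeBasis ν) * Uᴴ
        - curvature B p (spacetimeBasis μ) (spacetimeBasis ν)) with hd
  have hd0 : 0 ≤ d :=
    Finset.sum_nonneg fun _ _ => Finset.sum_nonneg fun _ _ => normSqTr_nonneg _
  have h : ∑ μ, ∑ ν, normSqTr (curvature B p (spacetimeBasis μ) (spacetimeBasis ν)) ≤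
      (1 + δ) * ∑ μ, ∑ ν, normSqTr (curvature A p (spacetimeBasis μ) (spacetimeBasis ν))
        + (1 + 1 / δ) * d := by
    simp only [hd, Finset.mul_sum, ← Finset.sum_add_distrib]
    refine Finset.sum_le_sum fun μ _ => Finset.sum_le_sum fun ν _ => ?_
    have h := normSqTr_le_add hδ
      (U * curvature A p (spacetimeBasis μ) (spacetimeBasis ν) * Uᴴ)
      (curvature B p (spacetimeBasis μ) (spacetimeBasis ν))
    rwa [normSqTr_unitary_conj hU] at h
  have h₁ : 0 ≤ (1 + 1 / δ) * d := by positivity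
  unfold energyDensity
  linarith

/-- Lower semicontinuity of the energy under convergence of curvatures modulo gauge. -/
theorem lintegral_energyDensity_le_of_converges {A : ℕ → Connection Spacetime}
    {U : ℕ → Spacetime → Mat2} {B : Connection Spacetime}
    (hU : ∀ n, IsGaugeOn (U n) (slab (-1) 1)) (hconv : CurvatureConverges A U B)
    {K : Set Spacetime} (hK : IsCompact K) (hKs : K ⊆ slab (-1) 1)
    (hA : ∀ᶠ n in atTop, ContinuousOn (energyDensity (A n)) K) {C : ℝ≥0∞}
    (hC : ∀ᶠ n in atTop, ∫⁻ p in K, ENNReal.ofReal (energyDensity (A n) p) ≤ C) :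
    ∫⁻ p in K, ENNReal.ofReal (energyDensity B p) ≤ C := by
  have hδ : ∀ δ : ℝ, 0 < δ →
      ∫⁻ p in K, ENNReal.ofReal (energyDensity B p) ≤ ENNReal.ofReal (1 + δ) * C := by
    intro δ hδ
    have hlim := (ENNReal.Tendsto.const_mul (hconv K hK hKs)
      (Or.inr (ENNReal.ofReal_ne_top (r := 1 + 1 / δ)))).const_add (ENNReal.ofReal (1 + δ) * C)
    rw [mul_zero, add_zero] at hlim
    refine ge_of_tendsto hlim ?_
    filter_upwards [hA, hC] with n hAn hCn
    calc ∫⁻ p in K, ENNReal.ofReal (energyDensity B p)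
        ≤ ∫⁻ p in K, (ENNReal.ofReal (1 + δ) * ENNReal.ofReal (energyDensity (A n) p) +
            ENNReal.ofReal (1 + 1 / δ) * ENNReal.ofReal (∑ μ, ∑ ν, normSqTr
              (U n p * curvature (A n) p (spacetimeBasis μ) (spacetimeBasis ν) * (U n p)ᴴ
                - curvature B p (spacetimeBasis μ) (spacetimeBasis ν)))) := by
          refine setLIntegral_mono' hK.measurableSet fun p hp => ?_
          rw [← ENNReal.ofReal_mul (by positivity), ← ENNReal.ofReal_mul (by positivity),
            ← ENNReal.ofReal_add (mul_nonneg (by positivity) (energyDensity_nonneg _ _))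
              (mul_nonneg (by positivity) (Finset.sum_nonneg fun _ _ =>
                Finset.sum_nonneg fun _ _ => normSqTr_nonneg _))]
          exact ENNReal.ofReal_le_ofReal (energyDensity_le_add ((hU n).2 p (hKs hp)) hδ p)
      _ ≤ _ := by
          rw [lintegral_add_left' ((hAn.aemeasurable hK.measurableSet).ennreal_ofReal.const_mul _),
            lintegral_const_mul' _ _ ENNReal.ofReal_ne_top,
            lintegral_const_mul' _ _ ENNReal.ofReal_ne_top]
          gcongr
  have hlim : Tendsto (fun δ : ℝ => ENNReal.ofReal (1 + δ) * C) (𝓝[>] 0) (𝓝 (1 * C)) := by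
    refine ENNReal.Tendsto.mul_const ?_ (Or.inl one_ne_zero)
    have h : Tendsto (fun δ : ℝ => ENNReal.ofReal (1 + δ)) (𝓝 0) (𝓝 (ENNReal.ofReal (1 + 0))) :=
      ENNReal.tendsto_ofReal (tendsto_const_nhds.add tendsto_id)
    rw [add_zero, ENNReal.ofReal_one] at h
    exact h.mono_left nhdsWithin_le_nhds
  rw [one_mul] at hlim
  refine ge_of_tendsto hlim ?_
  filter_upwards [self_mem_nhdsWithin] with δ hδ' using hδ δ hδ'

theorem continuous_energyDensity {B : Connection Spacetime} (hB : IsSmoothConnectionOn B univ) :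
    Continuous (energyDensity B) := by
  have huniv : slab ⊥ ⊤ = univ := by
    ext p
    simp [slab]
  rw [← continuousOn_univ, ← huniv]
  exact (contDiffOn_energyDensity (by rwa [huniv])).continuousOn

/-- The compact subset `[-1/2, 1/2] × {|x| ≤ r}` of `(-1, 1) × ℝ⁴`; its time extent is `1`. -/
def unitCylinder (r : ℝ) : Set Spacetime := Icc (-(1 / 2)) (1 / 2) ×ˢ Metric.closedBall 0 r

theorem isCompact_unitCylinder (r : ℝ) : IsCompact (unitCylinder r) :=
  isCompact_Icc.prod (isCompact_closedBall 0 r)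

theorem unitCylinder_subset (r : ℝ) : unitCylinder r ⊆ slab (-1) 1 := by
  intro p hp
  have h₁ : (-1 : ℝ) < p.1 := lt_of_lt_of_le (by norm_num) hp.1.1
  have h₂ : p.1 < (1 : ℝ) := lt_of_le_of_lt hp.1.2 (by norm_num)
  exact ⟨by rw [← EReal.coe_one, ← EReal.coe_neg]; exact EReal.coe_lt_coe_iff.2 h₁,
    by exact_mod_cast EReal.coe_lt_coe_iff.2 h₂⟩

theorem volume_restrict_unitCylinder (r : ℝ) :
    (volume : Measure Spacetime).restrict (unitCylinder r) =
      (volume.restrict (Icc (-(1 / 2) : ℝ) (1 / 2))).prod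
        ((volume : Measure Space).restrict (Metric.closedBall 0 r)) := by
  rw [Measure.prod_restrict, ← Measure.volume_eq_prod]
  rfl

theorem setLIntegral_Icc_const (C : ℝ≥0∞) :
    ∫⁻ _ in Icc (-(1 / 2) : ℝ) (1 / 2), C = C := by
  rw [setLIntegral_const, Real.volume_Icc]
  norm_num

theorem lintegral_unitCylinder_le {A : Connection Spacetime} {C : ℝ≥0∞}
    (h : ∀ s ∈ Icc (-(1 / 2) : ℝ) (1 / 2), energy A s ≤ C) (r : ℝ) :
    ∫⁻ p in unitCylinder r, ENNReal.ofReal (energyDensity A p) ≤ C := by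
  rw [volume_restrict_unitCylinder]
  refine (lintegral_prod_le _).trans ?_
  rw [← setLIntegral_Icc_const C]
  exact setLIntegral_mono' measurableSet_Icc fun s hs =>
    (setLIntegral_le_lintegral _ _).trans (h s hs)

/-- For a travelling wave the energy of a ball at time `0` is controlled by the space-time integral
of the energy density over a larger cylinder. -/
theorem setLIntegral_closedBall_le_unitCylinder {B : Connection Spacetime}
    (hB : IsSmoothConnectionOn B univ) {v : Space}
    (hv : ∀ (h : ℝ) (p : Spacetime), B (p + (h, -(h • v))) = B p) (r : ℝ) :
    ∫⁻ x in Metric.closedBall 0 r, ENNReal.ofReal (energyDensity B (0, x)) ≤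
      ∫⁻ p in unitCylinder (r + ‖v‖), ENNReal.ofReal (energyDensity B p) := by
  have hcont := continuous_energyDensity hB
  rw [volume_restrict_unitCylinder,
    lintegral_prod _ hcont.measurable.ennreal_ofReal.aemeasurable, ← setLIntegral_Icc_const
      (∫⁻ x in Metric.closedBall 0 r, ENNReal.ofReal (energyDensity B (0, x)))]
  refine setLIntegral_mono' measurableSet_Icc fun s hs => ?_
  simp only [energyDensity_eq_of_velocity hv s]
  rw [← lintegral_indicator measurableSet_closedBall, ← lintegral_indicator
    measurableSet_closedBall, ← lintegral_add_right_eq_self _ (s • v)]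
  refine lintegral_mono fun x => ?_
  by_cases hx : x + s • v ∈ Metric.closedBall (0 : Space) r
  · have hs' : |s| ≤ 1 := (abs_le.2 hs).trans (by norm_num)
    have hx' : x ∈ Metric.closedBall (0 : Space) (r + ‖v‖) := by
      rw [mem_closedBall_zero_iff] at hx ⊢
      calc ‖x‖ = ‖x + s • v - s • v‖ := by rw [add_sub_cancel_right]
        _ ≤ ‖x + s • v‖ + ‖s • v‖ := norm_sub_le _ _
        _ ≤ r + ‖v‖ := by
          rw [norm_smul, Real.norm_eq_abs]
          exact add_le_add hx (mul_le_of_le_one_left (norm_nonneg _) hs')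
    rw [indicator_of_mem hx, indicator_of_mem hx']
  · rw [indicator_of_notMem hx]
    exact zero_le

/-- The energy of a solution bounds the energy of everything that it bubbles. -/
theorem energy_bubble_le {A : Connection Spacetime} {S : EReal} {T : ℝ}
    (hA : IsFiniteEnergyYMSolution A S (T : EReal)) {B : Connection Space}
    {Λ : Spacetime →L[ℝ] Spacetime} (hB : Bubbles A S T B Λ) {t : ℝ} (hSt : S < (t : EReal))
    (htT : t < T) (s : ℝ) : energy (lorentzTransform Λ B) s ≤ energy A t := by
  obtain ⟨hBell, hΛ, τ, l, x, U, hτ, hτT, hl, hlo, hU, hconv⟩ := hB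
  have hsm := isSmoothConnectionOn_lorentzTransform hBell.smooth Λ
  obtain ⟨v, hv⟩ := exists_velocity hΛ B
  have hTτ : Tendsto (fun n => T - τ n) atTop (𝓝 0) := by
    simpa using hτT.const_sub T
  have hlow : ∀ᶠ n in atTop, t < τ n - l n := by
    have h := hτT.sub (hlo.trans_tendsto hTτ)
    rw [sub_zero] at h
    exact h.eventually_const_lt htT
  have hup : ∀ᶠ n in atTop, τ n + l n < T := by
    filter_upwards [hlo.bound (by norm_num : (0 : ℝ) < 1 / 2)] with n hn
    have h := (hτ n).2
    rw [Real.norm_of_nonneg (hl n).le, Real.norm_of_nonneg (by linarith)] at hn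
    linarith
  -- for large `n` the rescaled cylinder lies between the times `t` and `T`
  have htime : ∀ᶠ n in atTop, ∀ r ∈ Icc (-(1 / 2) : ℝ) (1 / 2),
      t ≤ τ n + l n * r ∧ τ n + l n * r < T := by
    filter_upwards [hlow, hup] with n h₁ h₂ r hr
    have := hl n
    constructor <;> nlinarith [hr.1, hr.2]
  rw [energy_eq_of_velocity hv, energy_eq_lintegral]
  have hmeas : AEMeasurable (fun y : Space =>
      ENNReal.ofReal (energyDensity (lorentzTransform Λ B) (0, y))) volume :=
    ((continuous_energyDensity hsm).comp (by fun_prop)).measurable.ennreal_ofReal.aemeasurable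
  refine lintegral_le_of_forall_closedBall hmeas fun r => ?_
  refine (setLIntegral_closedBall_le_unitCylinder hsm hv r).trans ?_
  refine lintegral_energyDensity_le_of_converges hU hconv (isCompact_unitCylinder _)
    (unitCylinder_subset _) ?_ ?_
  · filter_upwards [htime] with n hn
    refine ContinuousOn.congr (continuousOn_const.mul
      ((contDiffOn_energyDensity hA.smooth).continuousOn.comp
        (f := fun p : Spacetime => (τ n + l n * p.1, x n + l n • p.2)) (by fun_prop)
        fun p hp => ?_)) fun p _ => energyDensity_rescale (l n) (τ n) (x n) A p
    have h := hn p.1 hp.1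
    exact ⟨hSt.trans_le (EReal.coe_le_coe_iff.2 h.1), EReal.coe_lt_coe_iff.2 h.2⟩
  · filter_upwards [htime] with n hn
    refine lintegral_unitCylinder_le (fun s hs => ?_) _
    rw [energy_rescale (hl n)]
    exact energy_antitone hA hSt (hn s hs).1 (EReal.coe_lt_coe_iff.2 (hn s hs).2)

end YangMills

theorem proposition3p2
    (hconj : YangMills.BubblingConjecture)
    (A : YangMills.Connection YangMills.Spacetime) (S : EReal) (T : ℝ)
    (hA : YangMills.IsFiniteEnergyYMSolution A S (T : EReal))
    (hT : YangMills.IsMaximalForwardTime A S (T : EReal))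
    (t₀ : ℝ) (hSt₀ : S < (t₀ : EReal)) (ht₀T : t₀ < T)
    (hA₀ : YangMills.secondChernNumber (YangMills.timeSlice t₀ A) = 0) :
    (∃ B Λ, YangMills.Bubbles A S T B Λ) ∧
    ∀ B Λ, YangMills.Bubbles A S T B Λ →
      ∀ (s N : ℝ),
        N = YangMills.secondChernNumber
          (YangMills.timeSlice s (YangMills.lorentzTransform Λ B)) →
        N ≠ 0 →
        ∀ t : ℝ, S < (t : EReal) → t < T →
          ENNReal.ofReal (2 * Real.pi ^ 2 * |N|) ≤ YangMills.energy A t := by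
  refine ⟨?_, ?_⟩
  · rcases hconj A S T (hSt₀.trans (EReal.coe_lt_coe_iff.2 ht₀T)) hA hT with h | ⟨T₀, hT₀, h⟩
    · exact absurd h (EReal.coe_ne_top T)
    · rwa [EReal.coe_injective hT₀]
  · rintro B Λ hB s N rfl - t hSt htT
    exact ((YangMills.ofReal_secondChernNumber_le_staticEnergy _).trans
      (YangMills.staticEnergy_timeSlice_le
        (YangMills.isSmoothConnectionOn_lorentzTransform hB.1.smooth Λ) s)).trans
      (YangMills.energy_bubble_le hA hB hSt htT s)
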